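/- Let $n\ge 2$ and let $k_0,\dots,k_{n-1}\ge 2$ be integers. Let $G=P_{k_0}\Box\cdots\Box P_{k_{n-1}}$ be the $n$-grid graph, that is, the Cartesian product of the paths $P_{k_i}$ with $k_i$ vertices: its vertices are the tuples $u=(u_0,\dots,u_{n-1})$ of integers with $0\le u_i\le k_i-1$, and $u,v$ are adjacent if and only if there is an index $i$ with $|u_i-v_i|=1$ and $u_j=v_j$ for all $j\ne i$. A matching preclusion set of a graph $H$ is a set $F\subseteq E(H)$ such that $H-F$ has neither a perfect matching (a matching covering all vertices) nor an almost perfect matching (a matching covering all vertices but exactly one); it is optimal if it has minimum cardinality among all matching preclusion sets of $H$. Theorem. Suppose that the order $k_0k_1\cdots k_{n-1}$ of $G$ is odd. Then a set $F\subseteq E(G)$ is an optimal matching preclusion set of $G$ if and only if there is a vertex $u=(u_0,\dots,u_{n-1})$ of $G$ with degree $d_G(u)=n+1$ and $\sum_{i=0}^{n-1}u_i$ odd such that $F$ is the set of all edges of $G$ incident with $u$. -/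

import Mathlib

namespace GridGraph

/-- The Cartesian product of a family of graphs: two tuples are adjacent when they differ in
exactly one coordinate and are adjacent there. -/
def cartesianProduct {ι : Type*} {V : ι → Type*} (H : ∀ i, SimpleGraph (V i)) :
    SimpleGraph (∀ i, V i) where
  Adj u v := ∃ i, (H i).Adj (u i) (v i) ∧ ∀ j, j ≠ i → u j = v j
  symm := ⟨fun _ _ ⟨i, hi, h⟩ => ⟨i, hi.symm, fun j hj => (h j hj).symm⟩⟩
  loopless := ⟨fun _ ⟨i, hi, _⟩ => (H i).loopless.irrefl _ hi⟩

/-- The grid graph with side lengths `k 0, …, k (n - 1)`: the Cartesian product of the paths with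
vertices `0, …, k i - 1`. -/
def gridGraph {n : ℕ} (k : Fin n → ℕ) : SimpleGraph (∀ i, Fin (k i)) :=
  cartesianProduct fun i => SimpleGraph.pathGraph (k i)

variable {V : Type*}

/-- `G` has a perfect matching. -/
def HasPerfectMatching (G : SimpleGraph V) : Prop :=
  ∃ M : G.Subgraph, M.IsPerfectMatching

/-- `G` has an almost perfect matching: one that covers all vertices but exactly one. -/
def HasAlmostPerfectMatching (G : SimpleGraph V) : Prop :=
  ∃ (M : G.Subgraph) (v : V), M.IsMatching ∧ M.verts = {v}ᶜ

/-- `F` is a set of edges of `G` whose deletion leaves neither a perfect nor an almost perfect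
matching. -/
def IsMatchingPreclusionSet (G : SimpleGraph V) (F : Set (Sym2 V)) : Prop :=
  F ⊆ G.edgeSet ∧ ¬ HasPerfectMatching (G.deleteEdges F) ∧
    ¬ HasAlmostPerfectMatching (G.deleteEdges F)

/-- A matching preclusion set of minimum cardinality. -/
def IsOptimalMatchingPreclusionSet (G : SimpleGraph V) (F : Set (Sym2 V)) : Prop :=
  IsMatchingPreclusionSet G F ∧
    ∀ F' : Set (Sym2 V), IsMatchingPreclusionSet G F' → F.encard ≤ F'.encard

end GridGraph

/-! All side lengths are odd, so the vertices of even coordinate sum outnumber those of odd sum by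
exactly one. An almost perfect matching therefore misses an even vertex and saturates the odd ones,
and isolating an odd vertex precludes every such matching. Conversely, if `F` precludes matchings,
Hall's theorem gives `X = S ∪ N(S)` with more odd than even vertices such that every edge from an
odd vertex in `X` to an even vertex outside lies in `F`. The theorem thus reduces to an
isoperimetric statement: a set of positive imbalance has at least `n + 1` such cut edges
(`isExpanding_oddBox`), and for `n ≥ 2` at least `n + 2` unless it has only one odd vertex
(`le_cutSize_or_exists_unique`).

The isoperimetric statement is proved by induction on the dimension. If every direction carries two
cut edges, there are at least `2 * n`. Otherwise some direction carries at most one, and the grid is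
a product of a smaller grid with a path in that direction. Every line then has imbalance at most `1`
or `0`, according to the parity of its first vertex, so `X` projects to a set `Y` of lines that is
again of positive imbalance. Each cut edge of `Y` lifts to a cut edge of `X`, and to two if both its
lines are uncut (`isExpanding_product`). -/

namespace GridGraph

/-! ### Cuts and imbalances on a path with an odd number of vertices. -/

section Cut

variable {V ε : Type*}

open Classical in
/-- For an edge with ends `x` (of level `c`) and `y` and a set of vertices containing `x` iff `a`
and `y` iff `b`: `1` if the end of odd level lies in the set and the other end does not,
and `0` otherwise. -/
noncomputable def cut (c : ℕ) (a b : Prop) : ℕ :=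
  if (Odd c ∧ a ∧ ¬ b) ∨ (¬ Odd c ∧ b ∧ ¬ a) then 1 else 0

open Classical in
/-- The number of vertices of odd level in `X` minus the number of those of even level. -/
noncomputable def imbalance (W : Finset V) (p : V → ℕ) (X : V → Prop) : ℤ :=
  ∑ v ∈ W, if X v then (if Odd (p v) then 1 else -1) else 0

/-- The number of edges joining a vertex of odd level in `X` to a vertex of even level outside. -/
noncomputable def cutSize (E : Finset ε) (s t : ε → V) (p : V → ℕ) (X : V → Prop) : ℕ :=
  ∑ e ∈ E, cut (p (s e)) (X (s e)) (X (t e))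

theorem cut_of_odd_of_mem {c : ℕ} {a b : Prop} (hc : Odd c) (ha : a) (hb : ¬ b) :
    cut c a b = 1 := by simp [cut, hc, ha, hb]

theorem cut_le_one (c : ℕ) (a b : Prop) : cut c a b ≤ 1 := by
  unfold cut; split_ifs <;> omega

theorem cut_swap {c d : ℕ} (h : Odd (c + d)) (a b : Prop) : cut c a b = cut d b a := by
  have : Odd c ↔ ¬ Odd d := by
    rw [Nat.odd_add] at h; rw [h, Nat.not_odd_iff_even]
  unfold cut
  classical by_cases hd : Odd d <;> simp [this, hd]

theorem cut_not (c : ℕ) (a b : Prop) : cut (c + 1) (¬ a) (¬ b) = cut c a b := by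
  unfold cut
  by_cases hd : Odd c <;> by_cases ha : a <;> by_cases hb : b <;>
    simp [Nat.odd_add_one, hd, ha, hb]

theorem cut_congr_level {c d : ℕ} (h : Odd c ↔ Odd d) (a b : Prop) : cut c a b = cut d a b := by
  unfold cut
  classical simp only [h]

/-- The imbalance of a set of vertices of a path with `2 * m + 1` vertices and first level `c`. -/
noncomputable def lineImbalance (m c : ℕ) (y : ℕ → Prop) : ℤ :=
  imbalance (Finset.range (2 * m + 1)) (fun j => c + j) y

/-- The cut size of a set of vertices of a path with `2 * m + 1` vertices and first level `c`. -/
noncomputable def lineCut (m c : ℕ) (y : ℕ → Prop) : ℕ :=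
  cutSize (Finset.range (2 * m)) id Nat.succ (fun j => c + j) y

open Classical in
theorem lineImbalance_succ (m c : ℕ) (y : ℕ → Prop) :
    lineImbalance (m + 1) c y = lineImbalance m c y
      + (if y (2 * m + 1) then (if Odd (c + 1) then 1 else -1) else 0)
      + (if y (2 * m + 2) then (if Odd c then 1 else -1) else 0) := by
  have h1 : Odd (c + (2 * m + 1)) ↔ Odd (c + 1) := by grind
  have h2 : Odd (c + (2 * m + 1 + 1)) ↔ Odd c := by grind
  unfold lineImbalance imbalance
  rw [show 2 * (m + 1) + 1 = 2 * m + 1 + 1 + 1 by ring, Finset.sum_range_succ,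
    Finset.sum_range_succ]
  simp only [h1, h2]

theorem lineCut_succ (m c : ℕ) (y : ℕ → Prop) :
    lineCut (m + 1) c y = lineCut m c y
      + cut c (y (2 * m)) (y (2 * m + 1)) + cut (c + 1) (y (2 * m + 1)) (y (2 * m + 2)) := by
  have h1 : Odd (c + (2 * m + 1)) ↔ Odd (c + 1) := by grind
  have h2 : Odd (c + 2 * m) ↔ Odd c := by grind
  unfold lineCut cutSize
  rw [show 2 * (m + 1) = 2 * m + 1 + 1 by ring, Finset.sum_range_succ, Finset.sum_range_succ]
  simp only [id, Nat.succ_eq_add_one]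
  rw [cut_congr_level h1, cut_congr_level h2]

open Classical in
-- The end terms strengthen `two_mul_lineImbalance_le` for the induction: two appended vertices meet
-- the old path only at `2 * m`, so membership of that end has to be recorded.
theorem two_mul_lineImbalance_add_le {c : ℕ} (hc : ¬ Odd c) (m : ℕ) (y : ℕ → Prop) :
    2 * lineImbalance m c y + (if y 0 then 1 else 0) + (if y (2 * m) then 1 else 0)
      ≤ lineCut m c y := by
  induction m with
  | zero =>
    simp only [lineImbalance, imbalance, lineCut, cutSize]
    by_cases h : y 0 <;> simp [h, hc]
  | succ m ih =>
    rw [lineImbalance_succ, lineCut_succ]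
    rw [show 2 * (m + 1) = 2 * m + 2 by ring]
    by_cases h0 : y (2 * m) <;> by_cases h1 : y (2 * m + 1) <;> by_cases h2 : y (2 * m + 2) <;>
      simp [h0, h1, h2, hc, cut, Nat.odd_add_one] at ih ⊢ <;> linarith

theorem two_mul_lineImbalance_le {c : ℕ} (hc : ¬ Odd c) (m : ℕ) (y : ℕ → Prop) :
    2 * lineImbalance m c y ≤ lineCut m c y := by
  have := two_mul_lineImbalance_add_le hc m y
  split_ifs at this <;> linarith

/-- Without cut edges the set contains both neighbours of each of its odd vertices. On a path with
even ends, such a set has more even than odd vertices unless it is empty. -/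
theorem eq_empty_of_lineCut_eq_zero {c : ℕ} (hc : ¬ Odd c) (m : ℕ) (y : ℕ → Prop)
    (h0 : lineCut m c y = 0) (hd : 0 ≤ lineImbalance m c y) :
    ∀ j < 2 * m + 1, ¬ y j := by
  induction m with
  | zero =>
    simp only [lineImbalance, imbalance] at hd
    intro j hj
    obtain rfl : j = 0 := by omega
    intro h
    simp [h, hc] at hd
  | succ m ih =>
    rw [lineCut_succ] at h0
    rw [lineImbalance_succ] at hd
    have hm : lineCut m c y = 0 := by omega
    have hle := two_mul_lineImbalance_le hc m y
    rw [hm] at hle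
    have e1 : cut c (y (2 * m)) (y (2 * m + 1)) = 0 := by omega
    have e2 : cut (c + 1) (y (2 * m + 1)) (y (2 * m + 2)) = 0 := by omega
    have hd' : 0 ≤ lineImbalance m c y := by
      by_cases h1 : y (2 * m + 1) <;> by_cases h2 : y (2 * m + 2) <;>
        simp [h1, h2, hc, cut, Nat.odd_add_one] at hd e2 <;> linarith
    have key := ih hm hd'
    have h1 : ¬ y (2 * m + 1) := fun h1 => by
      simp [cut, hc, h1, key (2 * m) (by omega)] at e1
    have h2 : ¬ y (2 * m + 2) := fun h2 => by
      simp [h1, h2, hc] at hd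
      push_cast at hle
      linarith
    intro j hj
    rcases Nat.lt_or_ge j (2 * m + 1) with h | h
    · exact key j h
    · obtain rfl | rfl : j = 2 * m + 1 ∨ j = 2 * m + 2 := by omega
      · exact h1
      · exact h2

theorem lineImbalance_neg_of_forall {c : ℕ} (hc : ¬ Odd c) (m : ℕ) (y : ℕ → Prop)
    (h : ∀ j < 2 * m + 1, Even j → y j) : lineImbalance m c y < 0 := by
  induction m with
  | zero => simp [lineImbalance, imbalance, h 0, hc]
  | succ m ih =>
    have := ih fun j hj hj' => h j (by omega) hj'
    rw [lineImbalance_succ]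
    have h2 := h (2 * m + 2) (by omega) (by grind)
    by_cases h1 : y (2 * m + 1) <;> simp [h1, h2, hc, Nat.odd_add_one] <;> linarith

theorem lineCut_not (m c : ℕ) (y : ℕ → Prop) :
    lineCut m (c + 1) (fun j => ¬ y j) = lineCut m c y := by
  unfold lineCut cutSize
  refine Finset.sum_congr rfl fun j _ => ?_
  rw [← cut_not (c + id j)]
  congr 1
  simp; ring

/-- Complementing the set and shifting all levels by one preserves cuts. As the whole path has
imbalance `1` here, this duality turns each fact on paths of even first level into one on paths of
odd first level. -/
theorem lineImbalance_not {c : ℕ} (hc : Odd c) (m : ℕ) (y : ℕ → Prop) :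
    lineImbalance m (c + 1) (fun j => ¬ y j) = lineImbalance m c y - 1 := by
  induction m with
  | zero => by_cases h : y 0 <;> simp [lineImbalance, imbalance, h, hc, Nat.odd_add_one]
  | succ m ih =>
    rw [lineImbalance_succ, lineImbalance_succ, ih]
    by_cases h1 : y (2 * m + 1) <;> by_cases h2 : y (2 * m + 2) <;>
      simp [h1, h2, hc, Nat.odd_add_one] <;> ring

theorem two_mul_lineImbalance_sub_le {c : ℕ} (hc : Odd c) (m : ℕ) (y : ℕ → Prop) :
    2 * (lineImbalance m c y - 1) ≤ lineCut m c y := by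
  rw [← lineImbalance_not hc, ← lineCut_not]
  exact two_mul_lineImbalance_le (by simpa [Nat.odd_add_one] using hc) _ _

theorem full_of_lineCut_eq_zero {c : ℕ} (hc : Odd c) (m : ℕ) (y : ℕ → Prop)
    (h0 : lineCut m c y = 0) (hd : 1 ≤ lineImbalance m c y) :
    ∀ j < 2 * m + 1, y j := by
  have := eq_empty_of_lineCut_eq_zero (c := c + 1) (by simpa [Nat.odd_add_one] using hc) m
    (fun j => ¬ y j) (by rw [lineCut_not, h0]) (by rw [lineImbalance_not hc]; linarith)
  simpa using this

theorem exists_mem_of_lineImbalance {c : ℕ} (hc : Odd c) (m : ℕ) (y : ℕ → Prop)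
    (hd : 1 ≤ lineImbalance m c y) : ∃ j < 2 * m + 1, Even j ∧ y j := by
  by_contra! H
  have := lineImbalance_neg_of_forall (c := c + 1) (by simpa [Nat.odd_add_one] using hc) m
    (fun j => ¬ y j) H
  rw [lineImbalance_not hc] at this
  linarith

theorem exists_not_mem_of_lineImbalance {c : ℕ} (hc : ¬ Odd c) (m : ℕ) (y : ℕ → Prop)
    (hd : 0 ≤ lineImbalance m c y) : ∃ j < 2 * m + 1, Even j ∧ ¬ y j := by
  by_contra! H
  exact absurd (lineImbalance_neg_of_forall hc m y H) (by linarith)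

end Cut

/-! ### Products with a path. -/

section Step

variable {V ε : Type*}

/-- Every set of vertices of positive imbalance has a cut of size at least `M`. -/
def IsExpanding (W : Finset V) (E : Finset ε) (s t : ε → V) (p : V → ℕ) (M : ℕ) : Prop :=
  ∀ X : V → Prop, 1 ≤ imbalance W p X → M ≤ cutSize E s t p X

/-- Every set of vertices of nonnegative imbalance that contains a vertex of odd level has a
nonempty cut. -/
def IsStrictlyExpanding (W : Finset V) (E : Finset ε) (s t : ε → V) (p : V → ℕ) : Prop :=
  ∀ X : V → Prop, (∃ v ∈ W, Odd (p v) ∧ X v) → 0 ≤ imbalance W p X → 1 ≤ cutSize E s t p X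

theorem imbalance_mono {W : Finset V} {p : V → ℕ} {X Y : V → Prop}
    (h1 : ∀ v ∈ W, Odd (p v) → X v → Y v) (h2 : ∀ v ∈ W, ¬ Odd (p v) → Y v → X v) :
    imbalance W p X ≤ imbalance W p Y := by
  refine Finset.sum_le_sum fun v hv => ?_
  by_cases ho : Odd (p v)
  · have := h1 v hv ho
    by_cases hx : X v
    · simp [hx, this hx]
    · by_cases hy : Y v <;> simp [hx, hy, ho]
  · have := h2 v hv ho
    by_cases hy : Y v
    · simp [hy, this hy]
    · by_cases hx : X v <;> simp [hx, hy, ho]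

theorem exists_odd_mem_of_imbalance_pos {W : Finset V} {p : V → ℕ} {X : V → Prop}
    (h : 1 ≤ imbalance W p X) : ∃ v ∈ W, Odd (p v) ∧ X v := by
  by_contra! H
  have : imbalance W p X ≤ 0 := Finset.sum_nonpos fun v hv => by
    by_cases hx : X v
    · have : ¬ Odd (p v) := fun ho => H v hv ho hx
      simp [hx, this]
    · simp [hx]
  linarith

/-- The sum of the line cuts in a product with a path with `2 * m + 1` vertices. -/
noncomputable def verticalCut (W : Finset V) (p : V → ℕ) (m : ℕ) (X : V → ℕ → Prop) : ℕ :=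
  ∑ v ∈ W, lineCut m (p v) (X v)

/-- The total of the cuts in the layers of a product with a path with `2 * m + 1` vertices. -/
noncomputable def horizontalCut (E : Finset ε) (s t : ε → V) (p : V → ℕ) (m : ℕ)
    (X : V → ℕ → Prop) : ℕ :=
  ∑ e ∈ E, ∑ j ∈ Finset.range (2 * m + 1), cut (p (s e) + j) (X (s e) j) (X (t e) j)

/-- The sum of the line imbalances in a product with a path with `2 * m + 1` vertices. -/
noncomputable def productImbalance (W : Finset V) (p : V → ℕ) (m : ℕ) (X : V → ℕ → Prop) : ℤ :=
  ∑ v ∈ W, lineImbalance m (p v) (X v)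

/-- Edges are stored without regard to parity; this names the odd end `o` and the even end `w`,
uniformly in the set and in the layer `j`. -/
theorem exists_oriented {W : Finset V} {E : Finset ε} {s t : ε → V} {p : V → ℕ}
    (hs : ∀ e ∈ E, s e ∈ W) (ht : ∀ e ∈ E, t e ∈ W) (hp : ∀ e ∈ E, Odd (p (s e) + p (t e)))
    {e : ε} (he : e ∈ E) :
    ∃ o ∈ W, ∃ w ∈ W, Odd (p o) ∧ ¬ Odd (p w) ∧
      (∀ Y : V → Prop, cut (p (s e)) (Y (s e)) (Y (t e)) = cut (p o) (Y o) (Y w)) ∧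
      ∀ (Y : V → ℕ → Prop) (j : ℕ), cut (p (s e) + j) (Y (s e) j) (Y (t e) j) =
        cut (p o + j) (Y o j) (Y w j) := by
  have h := hp e he
  by_cases ho : Odd (p (s e))
  · exact ⟨s e, hs e he, t e, ht e he, ho, by grind, fun _ => rfl, fun _ _ => rfl⟩
  · refine ⟨t e, ht e he, s e, hs e he, by grind, ho, fun Y => cut_swap h _ _, fun Y j => ?_⟩
    exact cut_swap (by grind) _ _

/-- The lines of imbalance at least `1` that start at odd level and those of negative imbalance
that start at even level. -/
def unbalancedLines (p : V → ℕ) (m : ℕ) (X : V → ℕ → Prop) (v : V) : Prop :=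
  if Odd (p v) then 1 ≤ lineImbalance m (p v) (X v) else lineImbalance m (p v) (X v) < 0

theorem lineImbalance_le_one {c m : ℕ} {y : ℕ → Prop} (hc : Odd c) (h : lineCut m c y ≤ 1) :
    lineImbalance m c y ≤ 1 := by
  have := two_mul_lineImbalance_sub_le hc m y
  omega

theorem lineImbalance_nonpos {c m : ℕ} {y : ℕ → Prop} (hc : ¬ Odd c) (h : lineCut m c y ≤ 1) :
    lineImbalance m c y ≤ 0 := by
  have := two_mul_lineImbalance_le hc m y
  omega

/-- With at most one cut edge per line, a line contributes at most `1` or `0`; `unbalancedLines`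
collects the odd lines that attain the bound and the even lines that miss it. -/
theorem productImbalance_le {W : Finset V} {p : V → ℕ} {m : ℕ} {X : V → ℕ → Prop}
    (hC : ∀ v ∈ W, lineCut m (p v) (X v) ≤ 1) :
    productImbalance W p m X ≤ imbalance W p (unbalancedLines p m X) := by
  refine Finset.sum_le_sum fun v hv => ?_
  have h1 := hC v hv
  unfold unbalancedLines
  by_cases ho : Odd (p v)
  · have := lineImbalance_le_one ho h1
    by_cases hd : 1 ≤ lineImbalance m (p v) (X v) <;> simp [ho, hd] <;> omega
  · have := lineImbalance_nonpos ho h1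
    by_cases hd : lineImbalance m (p v) (X v) < 0 <;> simp [ho, hd] <;> omega

/-- One of the two lines is uncut, hence full (the odd one) or empty (the even one). The other only
has to supply a suitable vertex at an even offset, where the parity of the ends is unchanged. -/
theorem one_le_sum_cut {m c d : ℕ} {y z : ℕ → Prop} (hc : Odd c) (hd : ¬ Odd d)
    (hy : 1 ≤ lineImbalance m c y) (hz : 0 ≤ lineImbalance m d z)
    (h : lineCut m c y + lineCut m d z ≤ 1) :
    1 ≤ ∑ j ∈ Finset.range (2 * m + 1), cut (c + j) (y j) (z j) := by
  obtain ⟨j, hj, he, h1, h2⟩ : ∃ j < 2 * m + 1, Even j ∧ y j ∧ ¬ z j := by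
    rcases Nat.eq_zero_or_pos (lineCut m c y) with h0 | h0
    · obtain ⟨j, hj, he, h1⟩ := exists_not_mem_of_lineImbalance hd m z hz
      exact ⟨j, hj, he, full_of_lineCut_eq_zero hc m y h0 hy j hj, h1⟩
    · obtain ⟨j, hj, he, h1⟩ := exists_mem_of_lineImbalance hc m y hy
      exact ⟨j, hj, he, h1, eq_empty_of_lineCut_eq_zero hd m z (by omega) hz j hj⟩
  refine (cut_of_odd_of_mem (c := c + j) (by grind) h1 h2).ge.trans ?_
  exact Finset.single_le_sum (f := fun j => cut (c + j) (y j) (z j)) (fun _ _ => Nat.zero_le _)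
    (Finset.mem_range.2 hj)

theorem two_le_sum_cut_of_ne {N c : ℕ} {y z : ℕ → Prop} {i j : ℕ} (hi : i < N) (hj : j < N)
    (hij : i ≠ j) (h1 : cut (c + i) (y i) (z i) = 1) (h2 : cut (c + j) (y j) (z j) = 1) :
    2 ≤ ∑ j ∈ Finset.range N, cut (c + j) (y j) (z j) := by
  have := Finset.sum_le_sum_of_subset (f := fun j => cut (c + j) (y j) (z j))
    (show ({i, j} : Finset ℕ) ⊆ Finset.range N by
      intro x hx; simp at hx ⊢; omega)
  rw [Finset.sum_pair hij, h1, h2] at this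
  exact this

theorem two_le_sum_cut {m c d : ℕ} {y z : ℕ → Prop} (hm : 1 ≤ m) (hc : Odd c) (hd : ¬ Odd d)
    (hy : 1 ≤ lineImbalance m c y) (hz : 0 ≤ lineImbalance m d z)
    (h1 : lineCut m c y = 0) (h2 : lineCut m d z = 0) :
    2 ≤ ∑ j ∈ Finset.range (2 * m + 1), cut (c + j) (y j) (z j) := by
  have a := full_of_lineCut_eq_zero hc m y h1 hy
  have b := eq_empty_of_lineCut_eq_zero hd m z h2 hz
  -- The odd line is full and the even one empty, so every even offset gives a cut edge; `1 ≤ m`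
  -- makes room for the offsets `0` and `2`.
  exact two_le_sum_cut_of_ne (i := 0) (j := 2) (by omega) (by omega) (by omega)
    (cut_of_odd_of_mem (by grind) (a 0 (by omega)) (b 0 (by omega)))
    (cut_of_odd_of_mem (by grind) (a 2 (by omega)) (b 2 (by omega)))

theorem exists_cut_of_one_le_cutSize {E : Finset ε} {s t : ε → V} {p : V → ℕ} {X : V → Prop}
    (h : 1 ≤ cutSize E s t p X) : ∃ e ∈ E, cut (p (s e)) (X (s e)) (X (t e)) = 1 := by
  by_contra! H
  have : cutSize E s t p X = 0 := Finset.sum_eq_zero fun e he => by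
    have := cut_le_one (p (s e)) (X (s e)) (X (t e))
    have := H e he
    omega
  omega

theorem cut_odd_eq_one_iff {c : ℕ} {a b : Prop} (hc : Odd c) : cut c a b = 1 ↔ a ∧ ¬ b := by
  classical simp [cut, hc]

theorem cut_even_eq_one_iff {c : ℕ} {a b : Prop} (hc : ¬ Odd c) : cut c a b = 1 ↔ b ∧ ¬ a := by
  classical simp [cut, hc]

/-- Applied to the singleton `{u}`, strict expansion says that `u` is not isolated. -/
theorem exists_edge_of_isStrictlyExpanding {W : Finset V} {E : Finset ε} {s t : ε → V}
    {p : V → ℕ} (hs : ∀ e ∈ E, s e ∈ W) (ht : ∀ e ∈ E, t e ∈ W)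
    (hp : ∀ e ∈ E, Odd (p (s e) + p (t e))) (hQ : IsStrictlyExpanding W E s t p)
    {u : V} (hu : u ∈ W) (ho : Odd (p u)) :
    ∃ e ∈ E, ∃ w ∈ W, ¬ Odd (p w) ∧
      (∀ Y : V → Prop, cut (p (s e)) (Y (s e)) (Y (t e)) = cut (p u) (Y u) (Y w)) ∧
      ∀ (Y : V → ℕ → Prop) (j : ℕ), cut (p (s e) + j) (Y (s e) j) (Y (t e) j) =
        cut (p u + j) (Y u j) (Y w j) := by
  have h1 := hQ (fun v => v = u) ⟨u, hu, ho, rfl⟩ (Finset.sum_nonneg fun v _ => by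
    by_cases h : v = u <;> simp [h, ho])
  obtain ⟨e, he, h1⟩ := exists_cut_of_one_le_cutSize h1
  obtain ⟨o, hoW, w, hw, hoo, hww, hY, hYj⟩ := exists_oriented hs ht hp he
  rw [hY fun v => v = u, cut_odd_eq_one_iff hoo] at h1
  obtain rfl := h1.1
  exact ⟨e, he, w, hw, hww, hY, hYj⟩

/-- Products with paths with an odd number of vertices inherit `IsStrictlyExpanding`. -/
theorem isStrictlyExpanding_product {W : Finset V} {E : Finset ε} {s t : ε → V}
    {p : V → ℕ} (hs : ∀ e ∈ E, s e ∈ W) (ht : ∀ e ∈ E, t e ∈ W)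
    (hp : ∀ e ∈ E, Odd (p (s e) + p (t e))) (hQ : IsStrictlyExpanding W E s t p) {m : ℕ}
    {X : V → ℕ → Prop} (hX : 0 ≤ productImbalance W p m X)
    (hne : ∃ v ∈ W, ∃ j < 2 * m + 1, Odd (p v + j) ∧ X v j) :
    1 ≤ verticalCut W p m X + horizontalCut E s t p m X := by
  by_contra! H
  have hv : verticalCut W p m X = 0 := by omega
  have hh : horizontalCut E s t p m X = 0 := by omega
  have hC : ∀ v ∈ W, lineCut m (p v) (X v) = 0 := by simpa [verticalCut] using hv
  have hE : ∀ e ∈ E, ∑ j ∈ Finset.range (2 * m + 1),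
      cut (p (s e) + j) (X (s e) j) (X (t e) j) = 0 := by
    intro e he
    exact (Finset.sum_eq_zero_iff.1 hh) e he
  have hY := hX.trans (productImbalance_le fun v hv => by simp [hC v hv])
  by_cases hodd : ∃ v ∈ W, Odd (p v) ∧ unbalancedLines p m X v
  · obtain ⟨e, he, h1⟩ := exists_cut_of_one_le_cutSize (hQ _ hodd hY)
    obtain ⟨o, hoW, w, hw, hoo, hww, hY, hYj⟩ := exists_oriented hs ht hp he
    rw [hY, cut_odd_eq_one_iff hoo] at h1
    simp only [unbalancedLines, hoo, hww, if_true, if_false, not_lt] at h1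
    have := one_le_sum_cut hoo hww h1.1 h1.2 (by simp [hC o hoW, hC w hw])
    have h0 := hE e he
    simp only [hYj] at h0
    omega
  -- No odd line has positive imbalance, so all line imbalances vanish and the even lines are empty.
  -- An odd vertex of the set then lies on an odd line, and an edge to a neighbouring even line is
  -- cut.
  · push Not at hodd
    have hle : ∀ v ∈ W, lineImbalance m (p v) (X v) ≤ 0 := by
      intro v hv
      by_cases ho : Odd (p v)
      · have := hodd v hv ho
        simp only [unbalancedLines, ho, if_true] at this
        omega
      · exact lineImbalance_nonpos ho (by simp [hC v hv])
    have hz : ∀ v ∈ W, lineImbalance m (p v) (X v) = 0 :=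
      (Finset.sum_eq_zero_iff_of_nonpos hle).1 (le_antisymm (Finset.sum_nonpos hle) hX)
    have hempty : ∀ w ∈ W, ¬ Odd (p w) → ∀ j < 2 * m + 1, ¬ X w j := fun w hw hw' =>
      eq_empty_of_lineCut_eq_zero hw' m _ (hC w hw) (hz w hw).ge
    obtain ⟨u, hu, j, hj, huj, hX⟩ := hne
    have ho : Odd (p u) := by
      by_contra ho
      exact hempty u hu ho j hj hX
    obtain ⟨e, he, w, hw, hww, -, hYj⟩ := exists_edge_of_isStrictlyExpanding hs ht hp hQ hu ho
    have h0 := (Finset.sum_eq_zero_iff.1 (hE e he)) j (Finset.mem_range.2 hj)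
    rw [hYj, cut_of_odd_of_mem huj hX (hempty w hw hww j hj)] at h0
    omega

/-- A set of positive imbalance in a product with a path, if it has at most one cut edge along the
path, has a cut that is larger by `1` than the bound for the other factor, and larger by `2` unless
only one vertex of odd level belongs to it. -/
theorem isExpanding_product {W : Finset V} {E : Finset ε} {s t : ε → V}
    {p : V → ℕ} (hs : ∀ e ∈ E, s e ∈ W) (ht : ∀ e ∈ E, t e ∈ W)
    (hp : ∀ e ∈ E, Odd (p (s e) + p (t e))) (hQ : IsStrictlyExpanding W E s t p) {M m : ℕ}
    (hP : IsExpanding W E s t p M) (hM : 1 ≤ M) (hm : 1 ≤ m)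
    {X : V → ℕ → Prop} (hX : 1 ≤ productImbalance W p m X) (hC : verticalCut W p m X ≤ 1) :
    M + 1 ≤ verticalCut W p m X + horizontalCut E s t p m X ∧
      (2 ≤ M → M + 2 ≤ verticalCut W p m X + horizontalCut E s t p m X ∨
        ∃ x ∈ W, ∃ i < 2 * m + 1, ∀ v ∈ W, ∀ j < 2 * m + 1, Odd (p v + j) → X v j →
          v = x ∧ j = i) := by
  classical
  have hC1 : ∀ v ∈ W, lineCut m (p v) (X v) ≤ 1 := fun v hv =>
    (Finset.single_le_sum (f := fun v => lineCut m (p v) (X v)) (fun _ _ => Nat.zero_le _)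
      hv).trans hC
  have hC2 : ∀ v ∈ W, ∀ w ∈ W, v ≠ w → lineCut m (p v) (X v) + lineCut m (p w) (X w) ≤ 1 := by
    intro v hv w hw hvw
    rw [← Finset.sum_pair hvw (f := fun v => lineCut m (p v) (X v))]
    exact (Finset.sum_le_sum_of_subset (by intro x; simp; rintro (rfl | rfl) <;> assumption)).trans
      hC
  set Y := unbalancedLines p m X with hYdef
  have hY : 1 ≤ imbalance W p Y := hX.trans (productImbalance_le hC1)
  have hMY := hP Y hY
  have key : ∀ e ∈ E, cut (p (s e)) (Y (s e)) (Y (t e)) ≤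
      ∑ j ∈ Finset.range (2 * m + 1), cut (p (s e) + j) (X (s e) j) (X (t e) j) := by
    intro e he
    obtain ⟨o, hoW, w, hw, hoo, hww, hY, hYj⟩ := exists_oriented hs ht hp he
    simp only [hYj, hY]
    by_cases h1 : cut (p o) (Y o) (Y w) = 1
    · rw [h1]
      rw [cut_odd_eq_one_iff hoo] at h1
      simp only [hYdef, unbalancedLines, hoo, hww, if_true, if_false, not_lt] at h1
      exact one_le_sum_cut hoo hww h1.1 h1.2 (hC2 o hoW w hw (by rintro rfl; exact hww hoo))
    · have := cut_le_one (p o) (Y o) (Y w)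
      omega
  have key2 : ∀ e ∈ E, ∀ o ∈ W, ∀ w ∈ W, Odd (p o) → ¬ Odd (p w) → Y o → ¬ Y w →
      (∀ (Y : V → ℕ → Prop) (j : ℕ), cut (p (s e) + j) (Y (s e) j) (Y (t e) j) =
        cut (p o + j) (Y o j) (Y w j)) →
      lineCut m (p o) (X o) = 0 → lineCut m (p w) (X w) = 0 →
      2 ≤ ∑ j ∈ Finset.range (2 * m + 1), cut (p (s e) + j) (X (s e) j) (X (t e) j) := by
    intro e he o hoW w hw hoo hww hYo hYw hYj h1 h2
    simp only [hYdef, unbalancedLines, hoo, hww, if_true, if_false, not_lt] at hYo hYw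
    simp only [hYj]
    exact two_le_sum_cut hm hoo hww hYo hYw h1 h2
  have hhor : cutSize E s t p Y ≤ horizontalCut E s t p m X := Finset.sum_le_sum key
  rcases Nat.eq_zero_or_pos (verticalCut W p m X) with h0 | h0
  -- All lines are uncut, so every cut edge of `Y` counts twice, and `2 * M` is at least `M + 1`, or
  -- `M + 2` if `2 ≤ M`.
  · have hz : ∀ v ∈ W, lineCut m (p v) (X v) = 0 := by simpa [verticalCut] using h0
    have : 2 * cutSize E s t p Y ≤ horizontalCut E s t p m X := by
      unfold cutSize horizontalCut
      rw [Finset.mul_sum]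
      refine Finset.sum_le_sum fun e he => ?_
      obtain ⟨o, hoW, w, hw, hoo, hww, hY', hYj⟩ := exists_oriented hs ht hp he
      have := cut_le_one (p (s e)) (Y (s e)) (Y (t e))
      by_cases h1 : cut (p (s e)) (Y (s e)) (Y (t e)) = 1
      · rw [h1]
        rw [hY', cut_odd_eq_one_iff hoo] at h1
        exact key2 e he o hoW w hw hoo hww h1.1 h1.2 hYj (hz o hoW) (hz w hw)
      · rw [show cut (p (s e)) (Y (s e)) (Y (t e)) = 0 by omega]
        simp
    exact ⟨by omega, fun _ => Or.inl (by omega)⟩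
  · have hv1 : verticalCut W p m X = 1 := by omega
    refine ⟨by omega, fun _ => ?_⟩
    obtain ⟨x, hxW, hx⟩ : ∃ x ∈ W, lineCut m (p x) (X x) ≠ 0 := by
      by_contra! H
      exact absurd (Finset.sum_eq_zero H) (by unfold verticalCut at hv1; omega)
    have hz : ∀ v ∈ W, v ≠ x → lineCut m (p v) (X v) = 0 := fun v hv hvx => by
      have := hC2 v hv x hxW hvx
      omega
    -- the set `Y` modified at the exceptional line so that no edge of its cut meets that line
    let Z : V → Prop := fun v => if v = x then ¬ Odd (p x) else Y v
    have hZ : 0 ≤ imbalance W p Z := by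
      have hYZ : imbalance W p Y - 1 ≤ imbalance W p Z := by
        unfold imbalance
        rw [← Finset.add_sum_erase _ _ hxW, ← Finset.add_sum_erase _ _ hxW]
        have : ∀ v ∈ W.erase x, (if Y v then (if Odd (p v) then (1 : ℤ) else -1) else 0) =
            if Z v then (if Odd (p v) then (1 : ℤ) else -1) else 0 := by
          intro v hv
          simp [Z, Finset.ne_of_mem_erase hv]
        rw [Finset.sum_congr rfl this]
        by_cases ho : Odd (p x) <;> by_cases hy : Y x <;> simp [Z, ho, hy]
      omega
    by_cases hodd : ∃ v ∈ W, Odd (p v) ∧ Z v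
    · left
      have h1 := hQ Z hodd hZ
      -- A cut edge of `Z` avoids `x`, so it is also a cut edge of `Y` and joins two uncut lines: it
      -- lifts to two edges.
      have : cutSize E s t p Y + cutSize E s t p Z ≤ horizontalCut E s t p m X := by
        unfold cutSize horizontalCut
        rw [← Finset.sum_add_distrib]
        refine Finset.sum_le_sum fun e he => ?_
        obtain ⟨o, hoW, w, hw, hoo, hww, hY', hYj⟩ := exists_oriented hs ht hp he
        have a1 := cut_le_one (p (s e)) (Y (s e)) (Y (t e))
        have a2 := cut_le_one (p (s e)) (Z (s e)) (Z (t e))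
        by_cases h1 : cut (p (s e)) (Z (s e)) (Z (t e)) = 1
        · rw [hY', cut_odd_eq_one_iff hoo] at h1
          have hox : o ≠ x := by
            rintro rfl
            simp [Z, hoo] at h1
          have hwx : w ≠ x := by
            rintro rfl
            simp only [Z, hww, if_true, not_false_eq_true, not_true, and_false] at h1
          simp only [Z, hox, hwx, if_false] at h1
          have := key2 e he o hoW w hw hoo hww h1.1 h1.2 hYj (hz o hoW hox) (hz w hw hwx)
          omega
        · have := key e he
          omega
      omega
    · push Not at hodd
      by_contra! hcon
      obtain ⟨hcon, hmany⟩ := hcon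
      -- Fewer than `M + 2` cut edges in all leaves no slack: above each edge lie exactly as many
      -- cut edges as `Y` has on it. A second odd vertex of `X` will violate this.
      have hhe : horizontalCut E s t p m X = cutSize E s t p Y := by omega
      have hEe := (Finset.sum_eq_sum_iff_of_le key).1 hhe.symm
      obtain ⟨u, hu, huo, hYu⟩ := exists_odd_mem_of_imbalance_pos hY
      have hux : u = x := by
        by_contra hne
        exact hodd u hu huo (by simpa [Z, hne] using hYu)
      subst hux
      have hYodd : ∀ v ∈ W, v ≠ u → Odd (p v) → ¬ Y v := fun v hv hvu ho hYv =>
        hodd v hv ho (by simpa [Z, hvu] using hYv)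
      have hle : ∀ v ∈ W.erase u, lineImbalance m (p v) (X v) ≤ 0 := by
        intro v hv
        obtain ⟨hvu, hv⟩ := Finset.mem_erase.1 hv
        by_cases ho : Odd (p v)
        · have := hYodd v hv hvu ho
          simp only [hYdef, unbalancedLines, ho, if_true] at this
          omega
        · exact lineImbalance_nonpos ho (hC1 v hv)
      have hzero : ∀ v ∈ W.erase u, lineImbalance m (p v) (X v) = 0 := by
        refine (Finset.sum_eq_zero_iff_of_nonpos hle).1 (le_antisymm (Finset.sum_nonpos hle) ?_)
        have h1 := lineImbalance_le_one huo (hC1 u hu)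
        unfold productImbalance at hX
        rw [← Finset.add_sum_erase _ _ hu] at hX
        linarith
      have hempty : ∀ w ∈ W, ¬ Odd (p w) → ∀ j < 2 * m + 1, ¬ X w j := fun w hw hw' => by
        have hwu : w ≠ u := by rintro rfl; exact hw' huo
        exact eq_empty_of_lineCut_eq_zero hw' m _ (hz w hw hwu)
          (hzero w (Finset.mem_erase.2 ⟨hwu, hw⟩)).ge
      have hYu1 : 1 ≤ lineImbalance m (p u) (X u) := by
        simpa only [hYdef, unbalancedLines, huo, if_true] using hYu
      obtain ⟨i, hi, hie, hXi⟩ := exists_mem_of_lineImbalance huo m _ hYu1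
      obtain ⟨v, hv, j, hj, hvj, hXv, hne⟩ := hmany u hu i hi
      have hvo : Odd (p v) := by
        by_contra ho
        exact hempty v hv ho j hj hXv
      obtain ⟨e, he, w, hw, hww, hY', hYj⟩ :=
        exists_edge_of_isStrictlyExpanding hs ht hp hQ hv hvo
      have hee := hEe e he
      simp only [hYj, hY'] at hee
      have hcj : cut (p v + j) (X v j) (X w j) = 1 :=
        cut_of_odd_of_mem hvj hXv (hempty w hw hww j hj)
      by_cases hvu : v = u
      · subst hvu
        have hci : cut (p v + i) (X v i) (X w i) = 1 :=
          cut_of_odd_of_mem (by grind) hXi (hempty w hw hww i hi)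
        have := two_le_sum_cut_of_ne hj hi (hne rfl) hcj hci
        have := cut_le_one (p v) (Y v) (Y w)
        omega
      · have h1 : 1 ≤ ∑ j ∈ Finset.range (2 * m + 1), cut (p v + j) (X v j) (X w j) := by
          refine hcj.ge.trans ?_
          exact Finset.single_le_sum (f := fun j => cut (p v + j) (X v j) (X w j))
            (fun _ _ => Nat.zero_le _) (Finset.mem_range.2 hj)
        have h2 : cut (p v) (Y v) (Y w) = 1 := by
          have := cut_le_one (p v) (Y v) (Y w)
          omega
        rw [cut_odd_eq_one_iff hvo] at h2
        exact hYodd v hv hvu hvo h2.1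

end Step

/-! ### Induction on the dimension of the grid. -/

section Grid

variable {n : ℕ}

/-- The grid points `x` with `x i ≤ 2 * m i` for all `i`. -/
def oddBox (m : Fin n → ℕ) : Finset (Fin n → ℕ) :=
  Fintype.piFinset fun i => Finset.range (2 * m i + 1)

/-- The edges of the grid on `oddBox m`, given by their direction and lower end. -/
def oddBoxEdges (m : Fin n → ℕ) : Finset (Fin n × (Fin n → ℕ)) :=
  (Finset.univ ×ˢ oddBox m).filter fun e => e.2 e.1 < 2 * m e.1

/-- The upper end of an edge given by its direction and lower end. -/
def upperEnd (e : Fin n × (Fin n → ℕ)) : Fin n → ℕ :=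
  Function.update e.2 e.1 (e.2 e.1 + 1)

/-- The sum of the coordinates. -/
def level (x : Fin n → ℕ) : ℕ := ∑ i, x i

/-- The part of the cut that consists of edges of direction `i`. -/
noncomputable def directionCut (m : Fin n → ℕ) (X : (Fin n → ℕ) → Prop) (i : Fin n) : ℕ :=
  ∑ x ∈ oddBox m, if x i < 2 * m i then cut (level x) (X x) (X (upperEnd (i, x))) else 0

theorem mem_oddBox {m x : Fin n → ℕ} : x ∈ oddBox m ↔ ∀ i, x i < 2 * m i + 1 := by
  simp [oddBox]

theorem level_upperEnd (e : Fin n × (Fin n → ℕ)) : level (upperEnd e) = level e.2 + 1 := by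
  unfold level upperEnd
  rw [Finset.sum_update_of_mem (Finset.mem_univ _), ← Finset.add_sum_erase _ _
    (Finset.mem_univ e.1), Finset.sdiff_singleton_eq_erase]
  ring

theorem lowerEnd_mem_oddBox {m : Fin n → ℕ} : ∀ e ∈ oddBoxEdges m, e.2 ∈ oddBox m := by
  simp +contextual [oddBoxEdges]

theorem upperEnd_mem_oddBox {m : Fin n → ℕ} : ∀ e ∈ oddBoxEdges m, upperEnd e ∈ oddBox m := by
  intro e he
  simp only [oddBoxEdges, Finset.mem_filter, Finset.mem_product, Finset.mem_univ, true_and,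
    mem_oddBox] at he
  rw [mem_oddBox]
  intro j
  by_cases h : j = e.1
  · subst h; simp [upperEnd]; omega
  · simpa [upperEnd, h] using he.1 j

theorem odd_level_add_level (e : Fin n × (Fin n → ℕ)) : Odd (level e.2 + level (upperEnd e)) := by
  rw [level_upperEnd]; grind

theorem cutSize_oddBoxEdges (m : Fin n → ℕ) (X : (Fin n → ℕ) → Prop) :
    cutSize (oddBoxEdges m) Prod.snd upperEnd level X = ∑ i, directionCut m X i := by
  unfold cutSize oddBoxEdges directionCut
  rw [Finset.sum_filter, Finset.sum_product]

/-- The coordinate `i` is arbitrary because the induction splits off whichever direction has few cut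
edges. -/
theorem sum_oddBox_succ {M : Type*} [AddCommMonoid M] (m : Fin (n + 1) → ℕ) (i : Fin (n + 1))
    (f : (Fin (n + 1) → ℕ) → M) :
    ∑ x ∈ oddBox m, f x = ∑ v ∈ oddBox (i.removeNth m), ∑ j ∈ Finset.range (2 * m i + 1),
      f (i.insertNth j v) := by
  rw [← Finset.sum_product']
  refine Finset.sum_nbij' (fun x => (i.removeNth x, x i)) (fun y => i.insertNth y.2 y.1)
    ?_ ?_ ?_ ?_ ?_
  · intro x hx
    rw [mem_oddBox] at hx
    simp only [Finset.mem_product, mem_oddBox, Finset.mem_range]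
    exact ⟨fun j => hx _, hx i⟩
  · intro y hy
    simp only [Finset.mem_product, mem_oddBox, Finset.mem_range] at hy
    rw [mem_oddBox, Fin.forall_iff_succAbove i]
    simpa [Fin.removeNth] using hy.symm
  · intro x _; simp
  · intro y _; simp
  · intro x _; simp

theorem level_insertNth (i : Fin (n + 1)) (j : ℕ) (v : Fin n → ℕ) :
    level (i.insertNth j v : Fin (n + 1) → ℕ) = level v + j := by
  unfold level
  rw [Fin.sum_univ_succAbove _ i]
  simp [add_comm]

theorem imbalance_oddBox_succ (m : Fin (n + 1) → ℕ) (i : Fin (n + 1))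
    (X : (Fin (n + 1) → ℕ) → Prop) :
    imbalance (oddBox m) level X =
      productImbalance (oddBox (i.removeNth m)) level (m i) fun v j => X (i.insertNth j v) := by
  unfold imbalance
  rw [sum_oddBox_succ m i]
  simp only [level_insertNth]
  rfl

theorem directionCut_self (m : Fin (n + 1) → ℕ) (i : Fin (n + 1))
    (X : (Fin (n + 1) → ℕ) → Prop) :
    directionCut m X i =
      verticalCut (oddBox (i.removeNth m)) level (m i) fun v j => X (i.insertNth j v) := by
  unfold directionCut
  rw [sum_oddBox_succ m i]
  simp only [level_insertNth, upperEnd, Fin.insertNth_apply_same, Fin.update_insertNth]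
  refine Finset.sum_congr rfl fun v _ => ?_
  rw [Finset.sum_range_succ, if_neg (lt_irrefl _), add_zero]
  refine Finset.sum_congr rfl fun j hj => ?_
  rw [if_pos (Finset.mem_range.1 hj)]
  rfl

theorem sum_directionCut_succAbove (m : Fin (n + 1) → ℕ) (i : Fin (n + 1))
    (X : (Fin (n + 1) → ℕ) → Prop) :
    ∑ l, directionCut m X (i.succAbove l) =
      horizontalCut (oddBoxEdges (i.removeNth m)) Prod.snd upperEnd level (m i)
        fun v j => X (i.insertNth j v) := by
  unfold horizontalCut oddBoxEdges
  rw [Finset.sum_filter, Finset.sum_product]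
  refine Finset.sum_congr rfl fun l _ => ?_
  unfold directionCut
  rw [sum_oddBox_succ m i]
  refine Finset.sum_congr rfl fun v _ => ?_
  simp only [level_insertNth, upperEnd, Fin.insertNth_apply_succAbove, Fin.insertNth_update,
    Fin.removeNth]
  split_ifs <;> simp

theorem cutSize_oddBox_succ (m : Fin (n + 1) → ℕ) (i : Fin (n + 1))
    (X : (Fin (n + 1) → ℕ) → Prop) :
    cutSize (oddBoxEdges m) Prod.snd upperEnd level X =
      verticalCut (oddBox (i.removeNth m)) level (m i) (fun v j => X (i.insertNth j v)) +
      horizontalCut (oddBoxEdges (i.removeNth m)) Prod.snd upperEnd level (m i)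
        fun v j => X (i.insertNth j v) := by
  rw [cutSize_oddBoxEdges, Fin.sum_univ_succAbove _ i, directionCut_self,
    sum_directionCut_succAbove]

theorem isStrictlyExpanding_oddBox : ∀ {n : ℕ} (m : Fin n → ℕ),
    IsStrictlyExpanding (oddBox m) (oddBoxEdges m) Prod.snd upperEnd level := by
  intro n
  induction n with
  | zero =>
    rintro m X ⟨v, -, hv, -⟩
    simp [level] at hv
  | succ n ih =>
    rintro m X ⟨x, hx, ho, hX⟩ himb
    rw [imbalance_oddBox_succ m 0] at himb
    rw [cutSize_oddBox_succ m 0]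
    rw [mem_oddBox] at hx
    refine isStrictlyExpanding_product lowerEnd_mem_oddBox upperEnd_mem_oddBox
      (fun e _ => odd_level_add_level e) (ih _) himb
      ⟨Fin.removeNth 0 x, mem_oddBox.2 fun j => hx _, x 0, hx 0, ?_, ?_⟩
    · rw [← level_insertNth 0, Fin.insertNth_self_removeNth]
      exact ho
    · rwa [Fin.insertNth_self_removeNth]

theorem le_cutSize_of_two_le_directionCut {m : Fin n → ℕ} {X : (Fin n → ℕ) → Prop}
    (h : ∀ i, 2 ≤ directionCut m X i) :
    2 * n ≤ cutSize (oddBoxEdges m) Prod.snd upperEnd level X := by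
  rw [cutSize_oddBoxEdges]
  have := Finset.card_nsmul_le_sum Finset.univ (directionCut m X) 2 fun i _ => h i
  simp at this
  linarith

theorem isExpanding_oddBox : ∀ {n : ℕ} (m : Fin n → ℕ), (∀ i, 1 ≤ m i) →
    IsExpanding (oddBox m) (oddBoxEdges m) Prod.snd upperEnd level (n + 1) := by
  intro n
  induction n with
  | zero =>
    intro m _ X hX
    obtain ⟨v, -, hv, -⟩ := exists_odd_mem_of_imbalance_pos hX
    simp [level] at hv
  | succ n ih =>
    intro m hm X hX
    -- Either there are `2 * (n + 1)` cut edges, or some direction has at most one and the product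
    -- step applies.
    by_cases h : ∀ i, 2 ≤ directionCut m X i
    · have := le_cutSize_of_two_le_directionCut h
      omega
    · push Not at h
      obtain ⟨i, hi⟩ := h
      rw [directionCut_self] at hi
      rw [imbalance_oddBox_succ m i] at hX
      rw [cutSize_oddBox_succ m i]
      exact (isExpanding_product lowerEnd_mem_oddBox upperEnd_mem_oddBox
        (fun e _ => odd_level_add_level e) (isStrictlyExpanding_oddBox _)
        (ih (i.removeNth m) fun j => hm _) (by omega) (hm i) hX (by omega)).1

/-- In dimension at least two a set of positive imbalance with at most `n + 1` cut edges contains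
only one vertex of odd level. -/
theorem le_cutSize_or_exists_unique {n : ℕ} (hn : 2 ≤ n) {m : Fin n → ℕ} (hm : ∀ i, 1 ≤ m i)
    {X : (Fin n → ℕ) → Prop} (hX : 1 ≤ imbalance (oddBox m) level X) :
    n + 2 ≤ cutSize (oddBoxEdges m) Prod.snd upperEnd level X ∨
      ∃ x, ∀ y ∈ oddBox m, Odd (level y) → X y → y = x := by
  obtain ⟨n, rfl⟩ : ∃ k, n = k + 1 := ⟨n - 1, by omega⟩
  by_cases h : ∀ i, 2 ≤ directionCut m X i
  · have := le_cutSize_of_two_le_directionCut h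
    omega
  · push Not at h
    obtain ⟨i, hi⟩ := h
    rw [directionCut_self] at hi
    rw [imbalance_oddBox_succ m i] at hX
    rw [cutSize_oddBox_succ m i]
    obtain h | ⟨x, -, j, -, h⟩ := (isExpanding_product lowerEnd_mem_oddBox upperEnd_mem_oddBox
        (fun e _ => odd_level_add_level e) (isStrictlyExpanding_oddBox _)
        (isExpanding_oddBox (i.removeNth m) fun j => hm _) (by omega) (hm i) hX (by omega)).2
        (by omega)
    · exact Or.inl h
    · refine Or.inr ⟨i.insertNth j x, fun y hy ho hX => ?_⟩
      rw [mem_oddBox] at hy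
      obtain ⟨h1, h2⟩ := h (i.removeNth y) (mem_oddBox.2 fun j => hy _) (y i) (hy i)
        (by rwa [← level_insertNth i, Fin.insertNth_self_removeNth])
        (by rwa [Fin.insertNth_self_removeNth])
      rw [← h1, ← h2, Fin.insertNth_self_removeNth]

theorem lineImbalance_true (m c : ℕ) :
    lineImbalance m c (fun _ => True) = if Odd c then 1 else -1 := by
  induction m with
  | zero => by_cases h : Odd c <;> simp [lineImbalance, imbalance, h]
  | succ m ih =>
    rw [lineImbalance_succ, ih]
    by_cases h : Odd c <;> simp [h, Nat.odd_add_one]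

theorem imbalance_oddBox_true : ∀ {n : ℕ} (m : Fin n → ℕ),
    imbalance (oddBox m) level (fun _ => True) = -1 := by
  intro n
  induction n with
  | zero => intro m; simp [imbalance, level, oddBox]
  | succ n ih =>
    intro m
    rw [imbalance_oddBox_succ m 0, ← ih (Fin.removeNth 0 m)]
    exact Finset.sum_congr rfl fun v _ => by simp [lineImbalance_true]

end Grid

/-! ### Matchings and imbalances in bipartite graphs. -/

section Matching

variable {V : Type*} {H : SimpleGraph V} {p : V → ℕ}

open Classical in
theorem imbalance_eq_add_erase {W : Finset V} {u : V} (hu : u ∈ W) (X : V → Prop) :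
    imbalance W p X = (if X u then (if Odd (p u) then 1 else -1) else 0) +
      imbalance (W.erase u) p X := by
  exact (Finset.add_sum_erase W (fun v => if X v then (if Odd (p v) then (1 : ℤ) else -1) else 0)
    hu).symm

variable [Fintype V]

theorem imbalance_mem (S : Finset V) :
    imbalance Finset.univ p (· ∈ S) = imbalance S p fun _ => True := by
  unfold imbalance
  symm
  refine (Finset.sum_congr rfl fun v hv => ?_).trans
    (Finset.sum_subset (Finset.subset_univ S) fun v _ hv => ?_)
  · simp [hv]
  · simp [hv]

theorem imbalance_true_eq (p : V → ℕ) :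
    imbalance Finset.univ p (fun _ => True) =
      ((Finset.univ.filter fun v => Odd (p v)).card : ℤ) -
        (Finset.univ.filter fun v => ¬ Odd (p v)).card := by
  unfold imbalance
  simp only [if_true]
  rw [Finset.sum_ite]
  simp [sub_eq_add_neg]

/-- An injective choice of neighbours for the vertices of odd level gives an almost perfect
matching if the vertices of even level outnumber those of odd level by one. -/
theorem hasAlmostPerfectMatching_of_injective (hp : ∀ u v, H.Adj u v → Odd (p u + p v))
    (htot : imbalance Finset.univ p (fun _ => True) = -1) {f : {v // Odd (p v)} → V}
    (hf : Function.Injective f) (hadj : ∀ v : {v // Odd (p v)}, H.Adj v (f v)) :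
    HasAlmostPerfectMatching H := by
  classical
  have heven : ∀ v, ¬ Odd (p (f v)) := fun v => by
    have h1 := hp _ _ (hadj v)
    have h2 := v.2
    grind
  rw [imbalance_true_eq] at htot
  have hcard : ((Finset.univ.filter fun v => ¬ Odd (p v)) \ Finset.univ.image f).card = 1 := by
    rw [Finset.card_sdiff_of_subset (by
      intro v; simp only [Finset.mem_image, Finset.mem_filter, Finset.mem_univ, true_and]
      rintro ⟨a, rfl⟩; exact heven a), Finset.card_image_of_injective _ hf, Finset.card_univ,
      Fintype.card_subtype]
    omega
  obtain ⟨z, hz⟩ := Finset.card_eq_one.1 hcard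
  have hz' : ∀ v, (¬ Odd (p v) ∧ ∀ a, f a ≠ v) ↔ v = z := by
    intro v
    rw [← Finset.mem_singleton, ← hz]
    simp
  obtain ⟨hzo, hzf⟩ := (hz' z).2 rfl
  let M : H.Subgraph :=
    { verts := {z}ᶜ
      Adj := fun x y => (∃ h : Odd (p x), f ⟨x, h⟩ = y) ∨ ∃ h : Odd (p y), f ⟨y, h⟩ = x
      adj_sub := by
        rintro x y (⟨h, rfl⟩ | ⟨h, rfl⟩)
        · exact hadj ⟨x, h⟩
        · exact (hadj ⟨y, h⟩).symm
      edge_vert := by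
        rintro x y (⟨h, rfl⟩ | ⟨h, rfl⟩)
        · rintro rfl
          exact hzo h
        · exact hzf _
      symm := ⟨fun x y h => Or.symm h⟩ }
  refine ⟨M, z, fun v hv => ?_, rfl⟩
  by_cases ho : Odd (p v)
  · refine ⟨f ⟨v, ho⟩, Or.inl ⟨ho, rfl⟩, ?_⟩
    rintro y (⟨_, rfl⟩ | ⟨h, rfl⟩)
    · rfl
    · exact absurd ho (heven _)
  · have : ∃ a, f a = v := by
      by_contra! h
      exact hv ((hz' v).1 ⟨ho, h⟩)
    obtain ⟨a, rfl⟩ := this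
    refine ⟨a, Or.inr ⟨a.2, rfl⟩, ?_⟩
    rintro y (⟨h, -⟩ | ⟨h, hy⟩)
    · exact absurd h ho
    · exact congrArg Subtype.val (hf hy)

/-- Hall's theorem in terms of imbalances. -/
theorem hasAlmostPerfectMatching_or_exists_imbalance (hp : ∀ u v, H.Adj u v → Odd (p u + p v))
    (htot : imbalance Finset.univ p (fun _ => True) = -1) :
    HasAlmostPerfectMatching H ∨ ∃ X : V → Prop, 1 ≤ imbalance Finset.univ p X ∧
      ∀ u v, H.Adj u v → Odd (p u) → X u → X v := by
  classical
  by_cases hall : ∀ S : Finset {v // Odd (p v)},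
      S.card ≤ (S.biUnion fun v => H.neighborFinset v).card
  · left
    obtain ⟨f, hf, hmem⟩ := (Finset.all_card_le_biUnion_card_iff_exists_injective _).1 hall
    exact hasAlmostPerfectMatching_of_injective hp htot hf fun v => by simpa using hmem v
  · right
    push Not at hall
    obtain ⟨S, hS⟩ := hall
    set T := S.biUnion fun v => H.neighborFinset v with hT
    have hTmem : ∀ w, w ∈ T ↔ ∃ v ∈ S, H.Adj v w := by simp [hT]
    have hTe : ∀ w ∈ T, ¬ Odd (p w) := by
      intro w hw
      obtain ⟨v, -, h⟩ := (hTmem w).1 hw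
      have h1 := hp _ _ h
      have h2 := v.2
      grind
    -- The Hall violator together with its neighbourhood has imbalance `|S| - |T|`.
    refine ⟨fun v => (∃ h : Odd (p v), ⟨v, h⟩ ∈ S) ∨ v ∈ T, ?_, ?_⟩
    · have : imbalance Finset.univ p (fun v => (∃ h : Odd (p v), ⟨v, h⟩ ∈ S) ∨ v ∈ T) =
          (∑ v, if v ∈ S.map (Function.Embedding.subtype _) then (1 : ℤ) else 0) -
            ∑ v, if v ∈ T then (1 : ℤ) else 0 := by
        unfold imbalance
        rw [← Finset.sum_sub_distrib]
        refine Finset.sum_congr rfl fun v _ => ?_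
        by_cases ho : Odd (p v)
        · have : v ∉ T := fun h => hTe v h ho
          simp [ho, this]
        · simp [ho]
          split_ifs <;> rfl
      rw [this, Finset.sum_ite_mem, Finset.sum_ite_mem]
      simp
      omega
    · rintro u v huv ho (⟨h, hu⟩ | hu)
      · exact Or.inr ((hTmem v).2 ⟨_, hu, huv⟩)
      · exact absurd ho (hTe u hu)

/-- The signed count of the vertices of a matching in a bipartite graph vanishes. -/
theorem imbalance_verts_eq_zero (hp : ∀ u v, H.Adj u v → Odd (p u + p v)) {M : H.Subgraph}
    (hM : M.IsMatching) : imbalance Finset.univ p (· ∈ M.verts) = 0 := by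
  classical
  unfold imbalance
  rw [← Finset.sum_filter]
  choose g hg hg' using @hM
  replace hg : ∀ v hv, M.Adj v (g hv) := hg
  replace hg' : ∀ v hv y, M.Adj v y → y = g (v := v) hv := hg'
  have hmem : ∀ v hv, g (v := v) hv ∈ M.verts := fun v hv => M.edge_vert (hg v hv).symm
  -- Matching partners have opposite parity, so their terms cancel.
  refine Finset.sum_involution (fun v hv => g (v := v) (by simpa using hv)) ?_ ?_ ?_ ?_
  · intro v hv
    have := hp _ _ (M.adj_sub (hg v (by simpa using hv)))
    by_cases ho : Odd (p v)
    · have h2 : ¬ Odd (p (g (v := v) (by simpa using hv))) := by grind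
      simp [ho, h2]
    · have h2 : Odd (p (g (v := v) (by simpa using hv))) := by grind
      simp [ho, h2]
  · intro v hv _ h
    have := M.adj_sub (hg v (by simpa using hv))
    rw [h] at this
    exact H.loopless.irrefl _ this
  · intro v hv
    simpa using hmem v _
  · intro v hv
    have hv' : v ∈ M.verts := by simpa using hv
    exact (hg' _ (hmem v hv') v (hg v hv').symm).symm

/-- Deleting all edges at a vertex of odd level leaves no perfect or almost perfect matching. -/
theorem isMatchingPreclusionSet_incidenceSet (hp : ∀ u v, H.Adj u v → Odd (p u + p v))
    (htot : imbalance Finset.univ p (fun _ => True) = -1) {u : V} (hu : Odd (p u)) :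
    IsMatchingPreclusionSet H (H.incidenceSet u) := by
  classical
  have hiso : ∀ v, ¬ (H.deleteEdges (H.incidenceSet u)).Adj u v := by
    intro v h
    rw [SimpleGraph.deleteEdges_adj] at h
    exact h.2 ((H.mem_incidenceSet u v).2 h.1)
  refine ⟨H.incidenceSet_subset u, ?_, ?_⟩
  · rintro ⟨M, hM, hs⟩
    obtain ⟨v, hv, -⟩ := hM (hs u)
    exact hiso v (M.adj_sub hv)
  · rintro ⟨M, z, hM, hz⟩
    have huz : u = z := by
      by_contra hne
      obtain ⟨v, hv, -⟩ := hM (v := u) (by rw [hz]; exact hne)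
      exact hiso v (M.adj_sub hv)
    subst huz
    -- Omitting the odd vertex `u` from a total of `-1` leaves `-2`, whereas a matching covers a set
    -- of imbalance `0`.
    have h0 := imbalance_verts_eq_zero
      (fun x y h => hp x y (SimpleGraph.deleteEdges_le _ h)) hM
    have herase : imbalance (Finset.univ.erase u) p (· ∈ M.verts) =
        imbalance (Finset.univ.erase u) p fun _ => True := by
      unfold imbalance
      refine Finset.sum_congr rfl fun v hv => ?_
      simp [hz, Finset.ne_of_mem_erase hv]
    have h1 := imbalance_eq_add_erase (p := p) (Finset.mem_univ u) (· ∈ M.verts)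
    have h2 := imbalance_eq_add_erase (p := p) (Finset.mem_univ u) fun _ => True
    rw [h0, herase] at h1
    rw [htot] at h2
    simp [hz, hu] at h1 h2
    omega

end Matching

/-! ### Transfer to the grid graph. -/

section OddGrid

variable {n : ℕ}

/-- The coordinates of a vertex as natural numbers. -/
def coord {k : Fin n → ℕ} (u : ∀ i, Fin (k i)) : Fin n → ℕ := fun i => u i

theorem coord_injective {k : Fin n → ℕ} : Function.Injective (coord (k := k)) := fun _ _ h =>
  funext fun i => Fin.ext (congrFun h i)

theorem gridGraph_adj_iff {k : Fin n → ℕ} {u v : ∀ i, Fin (k i)} :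
    (gridGraph k).Adj u v ↔
      ∃ i, coord v = upperEnd (i, coord u) ∨ coord u = upperEnd (i, coord v) := by
  have key : ∀ (i : Fin n) (u v : ∀ i, Fin (k i)), coord v = upperEnd (i, coord u) ↔
      (u i : ℕ) + 1 = v i ∧ ∀ j, j ≠ i → u j = v j := by
    intro i u v
    simp only [upperEnd, Function.eq_update_iff, coord]
    constructor
    · rintro ⟨h1, h2⟩
      exact ⟨h1.symm, fun j hj => Fin.ext (h2 j hj).symm⟩
    · rintro ⟨h1, h2⟩
      exact ⟨h1.symm, fun j hj => by rw [h2 j hj]⟩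
  simp only [gridGraph, cartesianProduct, key, SimpleGraph.pathGraph_adj]
  refine exists_congr fun i => ⟨?_, ?_⟩
  · rintro ⟨h | h, hj⟩
    · exact Or.inl ⟨h, hj⟩
    · exact Or.inr ⟨h, fun j hne => (hj j hne).symm⟩
  · rintro (⟨h, hj⟩ | ⟨h, hj⟩)
    · exact ⟨Or.inl h, hj⟩
    · exact ⟨Or.inr h, fun j hne => (hj j hne).symm⟩

theorem odd_level_of_adj {k : Fin n → ℕ} (u v : ∀ i, Fin (k i)) (h : (gridGraph k).Adj u v) :
    Odd (level (coord u) + level (coord v)) := by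
  obtain ⟨i, h | h⟩ := gridGraph_adj_iff.1 h
  · rw [h]; exact odd_level_add_level (i, coord u)
  · rw [h, add_comm]; exact odd_level_add_level (i, coord v)

/-- A set of vertices as a predicate on all tuples of natural numbers. -/
def extend {k : Fin n → ℕ} (X : (∀ i, Fin (k i)) → Prop) (x : Fin n → ℕ) : Prop :=
  ∃ u, coord u = x ∧ X u

theorem extend_coord {k : Fin n → ℕ} {X : (∀ i, Fin (k i)) → Prop} {u : ∀ i, Fin (k i)} :
    extend X (coord u) ↔ X u :=
  ⟨fun ⟨_, hv, h⟩ => coord_injective hv ▸ h, fun h => ⟨u, rfl, h⟩⟩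

variable {m : Fin n → ℕ}

theorem coord_mem_oddBox (u : ∀ i, Fin (2 * m i + 1)) : coord u ∈ oddBox m :=
  mem_oddBox.2 fun i => (u i).2

theorem exists_coord_eq {x : Fin n → ℕ} (hx : x ∈ oddBox m) :
    ∃ u : ∀ i, Fin (2 * m i + 1), coord u = x :=
  ⟨fun i => ⟨x i, mem_oddBox.1 hx i⟩, rfl⟩

theorem imbalance_extend (X : (∀ i, Fin (2 * m i + 1)) → Prop) :
    imbalance (oddBox m) level (extend X) =
      imbalance Finset.univ (fun u => level (coord u)) X := by
  classical
  have : oddBox m = Finset.univ.image (coord (k := fun i => 2 * m i + 1)) := by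
    ext x
    simp only [Finset.mem_image, Finset.mem_univ, true_and]
    exact ⟨exists_coord_eq, by rintro ⟨u, rfl⟩; exact coord_mem_oddBox u⟩
  rw [this]
  unfold imbalance
  rw [Finset.sum_image fun _ _ _ _ h => coord_injective h]
  simp only [extend_coord]

theorem imbalance_univ_true :
    imbalance Finset.univ (fun u : ∀ i, Fin (2 * m i + 1) => level (coord u)) (fun _ => True) =
      -1 := by
  rw [← imbalance_extend, ← imbalance_oddBox_true m]
  refine Finset.sum_congr rfl fun x hx => ?_
  obtain ⟨u, rfl⟩ := exists_coord_eq hx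
  simp [extend_coord]

/-- The cut size of `X` is at most the size of any set containing all edges that join a vertex of
odd level in `X` to a vertex outside. -/
theorem cutSize_extend_le_encard {X : (∀ i, Fin (2 * m i + 1)) → Prop}
    {F : Set (Sym2 (∀ i, Fin (2 * m i + 1)))}
    (hF : ∀ u v, (gridGraph fun i => 2 * m i + 1).Adj u v → Odd (level (coord u)) → X u → ¬ X v →
      s(u, v) ∈ F) :
    (cutSize (oddBoxEdges m) Prod.snd upperEnd level (extend X) : ℕ∞) ≤ F.encard := by
  classical
  set C := (oddBoxEdges m).filter fun e =>
    cut (level e.2) (extend X e.2) (extend X (upperEnd e)) = 1 with hC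
  have hcard : cutSize (oddBoxEdges m) Prod.snd upperEnd level (extend X) = C.card := by
    rw [hC, Finset.card_filter]
    refine Finset.sum_congr rfl fun e _ => ?_
    have := cut_le_one (level e.2) (extend X e.2) (extend X (upperEnd e))
    split_ifs <;> omega
  rw [hcard, ← Set.encard_coe_eq_coe_finsetCard]
  -- The level rises by one along each edge, which rules out a coincidence with the ends swapped.
  have hinj : Set.InjOn (fun e : Fin n × (Fin n → ℕ) => s(e.2, upperEnd e)) C := by
    rintro e - e' - h
    have hl := level_upperEnd e
    have hl' := level_upperEnd e'
    rcases Sym2.eq_iff.1 h with ⟨h1, h2⟩ | ⟨h1, h2⟩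
    · obtain ⟨i, x⟩ := e
      obtain ⟨i', x'⟩ := e'
      obtain rfl : x = x' := h1
      refine Prod.ext ?_ rfl
      by_contra hne
      have := congrFun h2 i
      dsimp only at hne
      simp only [upperEnd, Function.update_self] at this
      rw [Function.update_of_ne hne] at this
      omega
    · rw [← h1] at hl'
      rw [h2] at hl
      omega
  rw [← hinj.encard_image, ← (Sym2.map.injective coord_injective).encard_image F]
  refine Set.encard_le_encard ?_
  rintro _ ⟨e, he, rfl⟩
  simp only [hC, Finset.coe_filter, Set.mem_ofPred_eq] at he
  obtain ⟨he, hcut⟩ := he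
  obtain ⟨u, hu⟩ := exists_coord_eq (lowerEnd_mem_oddBox e he)
  obtain ⟨v, hv⟩ := exists_coord_eq (upperEnd_mem_oddBox e he)
  have hadj : (gridGraph fun i => 2 * m i + 1).Adj u v :=
    gridGraph_adj_iff.2 ⟨e.1, Or.inl (by rw [hu, hv])⟩
  rw [← hu, ← hv, extend_coord, extend_coord] at hcut
  have hpar := odd_level_of_adj u v hadj
  refine ⟨s(u, v), ?_, by rw [Sym2.map_mk, hu, hv]⟩
  by_cases ho : Odd (level (coord u))
  · rw [cut_odd_eq_one_iff ho] at hcut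
    exact hF u v hadj ho hcut.1 hcut.2
  · rw [cut_even_eq_one_iff ho] at hcut
    rw [Sym2.eq_swap]
    exact hF v u hadj.symm (by grind) hcut.1 hcut.2

theorem encard_incidenceSet {V : Type*} [Fintype V] (G : SimpleGraph V) [DecidableRel G.Adj]
    (u : V) : (G.incidenceSet u).encard = G.degree u := by
  classical
  rw [← G.card_incidenceFinset_eq_degree, ← G.coe_incidenceFinset,
    Set.encard_coe_eq_coe_finsetCard]

/-- This is the expansion bound for the singleton `{u}`, all of whose cut edges are incident with
`u`. -/
theorem le_degree_of_odd (hm : ∀ i, 1 ≤ m i)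
    [DecidableRel (gridGraph fun i => 2 * m i + 1).Adj]
    {u : ∀ i, Fin (2 * m i + 1)} (hu : Odd (level (coord u))) :
    n + 1 ≤ (gridGraph fun i => 2 * m i + 1).degree u := by
  classical
  have h1 : 1 ≤ imbalance (oddBox m) level (extend (· = u)) := by
    rw [imbalance_extend]
    simp [imbalance, hu]
  have h2 := cutSize_extend_le_encard (X := (· = u))
    (F := (gridGraph fun i => 2 * m i + 1).incidenceSet u) (by
      rintro _ v hadj - rfl -
      exact (SimpleGraph.mem_incidenceSet _ _ _).2 hadj)
  rw [encard_incidenceSet] at h2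
  exact (isExpanding_oddBox m hm _ h1).trans (by exact_mod_cast h2)

theorem exists_odd_degree_le (hn : 1 ≤ n) (hm : ∀ i, 1 ≤ m i)
    [DecidableRel (gridGraph fun i => 2 * m i + 1).Adj] :
    ∃ u : ∀ i, Fin (2 * m i + 1), Odd (level (coord u)) ∧
      (gridGraph fun i => 2 * m i + 1).degree u ≤ n + 1 := by
  classical
  let i₀ : Fin n := ⟨0, hn⟩
  -- A vertex next to the corner at the origin: its only lower neighbour is the origin, and it has
  -- at most `n` upper ones.
  obtain ⟨u, hu⟩ := exists_coord_eq (m := m) (x := Pi.single i₀ 1) (mem_oddBox.2 fun i => by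
    have := hm i
    by_cases h : i = i₀
    · subst h; simp; omega
    · simp [h])
  refine ⟨u, by rw [hu]; simp [level], ?_⟩
  have hsub : ((gridGraph fun i => 2 * m i + 1).neighborFinset u).image coord ⊆
      insert 0 (Finset.univ.image fun i => upperEnd (i, coord u)) := by
    intro x hx
    obtain ⟨v, hv, rfl⟩ := Finset.mem_image.1 hx
    rw [SimpleGraph.mem_neighborFinset] at hv
    obtain ⟨i, h | h⟩ := gridGraph_adj_iff.1 hv
    · rw [h]
      exact Finset.mem_insert_of_mem (Finset.mem_image_of_mem _ (Finset.mem_univ i))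
    · refine Finset.mem_insert.2 (Or.inl ?_)
      have hl := level_upperEnd (i, coord v)
      rw [← h, hu] at hl
      simp [level] at hl
      ext j
      exact hl j
  rw [← SimpleGraph.card_neighborFinset_eq_degree,
    ← Finset.card_image_of_injective _ coord_injective]
  refine (Finset.card_le_card hsub).trans ((Finset.card_insert_le _ _).trans ?_)
  have := Finset.card_image_le (s := Finset.univ) (f := fun i => upperEnd (i, coord u))
  simp only [Finset.card_univ, Fintype.card_fin] at this
  omega

/-- A matching preclusion set with at most `n + 1` edges consists of the edges at a vertex of odd
level. -/
theorem exists_eq_incidenceSet (hn : 2 ≤ n) (hm : ∀ i, 1 ≤ m i)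
    [DecidableRel (gridGraph fun i => 2 * m i + 1).Adj]
    {F : Set (Sym2 (∀ i, Fin (2 * m i + 1)))}
    (hF : IsMatchingPreclusionSet (gridGraph fun i => 2 * m i + 1) F)
    (hcard : F.encard ≤ (n + 1 : ℕ)) :
    ∃ u : ∀ i, Fin (2 * m i + 1), (gridGraph fun i => 2 * m i + 1).degree u = n + 1 ∧
      Odd (level (coord u)) ∧ F = (gridGraph fun i => 2 * m i + 1).incidenceSet u := by
  classical
  obtain h | ⟨X, hX, hclosed⟩ := hasAlmostPerfectMatching_or_exists_imbalance
    (H := (gridGraph fun i => 2 * m i + 1).deleteEdges F) (p := fun u => level (coord u))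
    (fun u v h => odd_level_of_adj u v (SimpleGraph.deleteEdges_le _ h)) imbalance_univ_true
  · exact absurd h hF.2.2
  have hcut : ∀ u v, (gridGraph fun i => 2 * m i + 1).Adj u v → Odd (level (coord u)) → X u →
      ¬ X v → s(u, v) ∈ F := by
    intro u v hadj ho hu hv
    by_contra hmem
    exact hv (hclosed u v (SimpleGraph.deleteEdges_adj.2 ⟨hadj, hmem⟩) ho hu)
  have hle := (cutSize_extend_le_encard hcut).trans hcard
  have hle' : cutSize (oddBoxEdges m) Prod.snd upperEnd level (extend X) ≤ n + 1 := by
    exact_mod_cast hle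
  have hX' := hX
  rw [← imbalance_extend] at hX'
  obtain h | ⟨x, hx⟩ := le_cutSize_or_exists_unique hn hm hX'
  · omega
  obtain ⟨u, -, huo, hXu⟩ := exists_odd_mem_of_imbalance_pos hX
  have huniq : ∀ v, Odd (level (coord v)) → X v → v = u := fun v hv hXv =>
    coord_injective ((hx _ (coord_mem_oddBox v) hv (extend_coord.2 hXv)).trans
      (hx _ (coord_mem_oddBox u) huo (extend_coord.2 hXu)).symm)
  have hnoeven : ∀ w, ¬ Odd (level (coord w)) → ¬ X w := by
    intro w hw hXw
    have hwu : w ≠ u := by rintro rfl; exact hw huo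
    -- With `u` as the only odd vertex of `X`, an even vertex `w` of `X` would push the imbalance
    -- down to that of `{u, w}`, which is `0`.
    have h1 := imbalance_mono (W := Finset.univ) (p := fun u => level (coord u)) (X := X)
      (Y := fun v => v ∈ ({u, w} : Finset _))
      (fun v _ hv hXv => by simp [huniq v hv hXv])
      (fun v _ hv hvm => by
        rcases Finset.mem_insert.1 hvm with rfl | hvm
        · exact hXu
        · rw [Finset.mem_singleton.1 hvm]; exact hXw)
    have h2 : imbalance Finset.univ (fun u => level (coord u)) (fun v => v ∈ ({u, w} : Finset _)) =
        0 := by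
      rw [imbalance_mem]
      unfold imbalance
      rw [Finset.sum_pair hwu.symm]
      simp [huo, hw]
    omega
  have hsub : (gridGraph fun i => 2 * m i + 1).incidenceSet u ⊆ F := by
    intro e he
    induction e with
    | h a b =>
      obtain ⟨hab, hu⟩ := he
      have hab : (gridGraph fun i => 2 * m i + 1).Adj a b := hab
      have hedge : ∀ b, (gridGraph fun i => 2 * m i + 1).Adj u b → s(u, b) ∈ F := fun b hub =>
        hcut u b hub huo hXu (hnoeven b (by
          have := odd_level_of_adj u b hub
          grind))
      rcases Sym2.mem_iff.1 hu with rfl | rfl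
      · exact hedge _ hab
      · rw [Sym2.eq_swap]
        exact hedge _ hab.symm
  have hdeg := le_degree_of_odd hm huo
  have hFle : F.encard ≤ ((gridGraph fun i => 2 * m i + 1).incidenceSet u).encard := by
    rw [encard_incidenceSet]
    exact hcard.trans (by exact_mod_cast hdeg)
  -- The star at `u` lies in `F` and has at least `n + 1` edges, while `F` has at most that many.
  have heq : (gridGraph fun i => 2 * m i + 1).incidenceSet u = F :=
    (Set.toFinite _).eq_of_subset_of_encard_le hsub hFle
  refine ⟨u, le_antisymm ?_ hdeg, huo, heq.symm⟩
  rw [← heq, encard_incidenceSet] at hcard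
  exact_mod_cast hcard

end OddGrid

end GridGraph

/-! ### The characterisation of the optimal sets. -/

theorem mainTheorem3 (n : ℕ) (hn : 2 ≤ n) (k : Fin n → ℕ) (hk : ∀ i, 2 ≤ k i)
    (hodd : Odd (Fintype.card (∀ i, Fin (k i))))
    [DecidableRel (GridGraph.gridGraph k).Adj]
    (F : Set (Sym2 (∀ i, Fin (k i)))) :
    GridGraph.IsOptimalMatchingPreclusionSet (GridGraph.gridGraph k) F ↔
      ∃ u : ∀ i, Fin (k i),
        (GridGraph.gridGraph k).degree u = n + 1 ∧
        Odd (∑ i, (u i : ℕ)) ∧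
        F = (GridGraph.gridGraph k).incidenceSet u := by
  have hki : ∀ i, Odd (k i) := by
    simp only [Fintype.card_pi, Fintype.card_fin] at hodd
    exact fun i => hodd.of_dvd_nat (Finset.dvd_prod_of_mem k (Finset.mem_univ i))
  obtain ⟨m, rfl⟩ : ∃ m : Fin n → ℕ, k = fun i => 2 * m i + 1 := by
    choose m hm using hki
    exact ⟨m, funext hm⟩
  have hm : ∀ i, 1 ≤ m i := fun i => by
    have : 2 ≤ 2 * m i + 1 := hk i
    omega
  have hstar : ∀ u : ∀ i, Fin (2 * m i + 1), Odd (GridGraph.level (GridGraph.coord u)) →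
      GridGraph.IsMatchingPreclusionSet (GridGraph.gridGraph fun i => 2 * m i + 1)
        ((GridGraph.gridGraph fun i => 2 * m i + 1).incidenceSet u) := fun u hu =>
    GridGraph.isMatchingPreclusionSet_incidenceSet (p := fun u => GridGraph.level
      (GridGraph.coord u)) GridGraph.odd_level_of_adj GridGraph.imbalance_univ_true hu
  constructor
  · rintro ⟨hF, hmin⟩
    -- The star of an odd vertex of small degree bounds the minimum by `n + 1`.
    obtain ⟨u, hu, hdeg⟩ := GridGraph.exists_odd_degree_le (by omega) hm
    refine GridGraph.exists_eq_incidenceSet hn hm hF ((hmin _ (hstar u hu)).trans ?_)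
    rw [GridGraph.encard_incidenceSet]
    exact_mod_cast hdeg
  · rintro ⟨u, hdeg, hu, rfl⟩
    refine ⟨hstar u hu, fun F' hF' => ?_⟩
    rw [GridGraph.encard_incidenceSet, hdeg]
    by_contra! hlt
    obtain ⟨v, hv, -, rfl⟩ := GridGraph.exists_eq_incidenceSet hn hm hF' hlt.le
    rw [GridGraph.encard_incidenceSet, hv] at hlt
    exact lt_irrefl _ hlt
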